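/- Let $n$ be a positive integer and let $\mathcal G_1,\mathcal G_2$ be weighted undirected graphs on $n$ vertices with symmetric adjacency matrices $A,B\in[0,\infty)^{n\times n}$, with $i$th columns $a_i,b_i$. Assume that $\mathcal G_1,\mathcal G_2$ are isomorphic ($A=\Pi^\top B\Pi$ for some permutation matrix $\Pi$), that each is asymmetric (the identity is the only permutation matrix $\Pi$ with $A=\Pi^\top A\Pi$, resp. $B=\Pi^\top B\Pi$), and that each is friendly (the adjacency matrix has $n$ distinct eigenvalues and no eigenvector orthogonal to $\mathbf 1_n$). Let the interaction graph of $n$ agents be undirected and connected, with symmetric weights $w_{ij}=w_{ji}$ that are positive on its edges and zero otherwise. For an $n\times n$ matrix $V$ put $\mathrm{Proj}(V)=V(I_n-\tfrac1n\mathbf 1_n\mathbf 1_n^\top)$; for $y,z\in\mathbb R^n$ let $[y]_i$ be the $n\times n$ matrix with $i$th column $y$ and zeros elsewhere, and $[z]^i$ the one with $i$th row $z^\top$ and zeros elsewhere. Consider the system for $Q=(P_i,y_i,z_i,K_i,\lambda_i,\Theta_i,\Upsilon_i)_{i=1}^n$, with $P_i,K_i,\Theta_i,\Upsilon_i\in\mathbb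 R^{n\times n}$ and $y_i,z_i,\lambda_i\in\mathbb R^n$: $$\dot P_i=\mathrm{Proj}\Big\{-(P_ia_i-y_i)a_i^\top-b_i\lambda_i^\top-\sum_jw_{ij}(\Theta_i-\Theta_j)-\sum_jw_{ij}(P_i-P_j)-b_i(b_i^\top P_i-z_i^\top)\Big\},$$ $$\dot\lambda_i^\top=b_i^\top P_i-z_i^\top,\qquad \dot\Theta_i=\sum_jw_{ij}(P_i-P_j),\qquad \dot K_i=\sum_jw_{ij}(\Upsilon_i-\Upsilon_j),$$ $$\dot\Upsilon_i=[y_i]_i-[z_i]^i-\sum_jw_{ij}(K_i-K_j)-\sum_jw_{ij}(\Upsilon_i-\Upsilon_j),$$ $$\dot y_i=(P_ia_i-y_i)-(i\text{th column of }\Upsilon_i),\qquad \dot z_i^\top=\lambda_i^\top+(i\text{th row of }\Upsilon_i)+b_i^\top P_i-z_i^\top .$$ Then there is exactly one permutation matrix $\Pi^*$ with $A=(\Pi^*)^\top B\,\Pi^*$. For every initial state $Q(0)$ with $P_i(0)\mathbf 1_n=\mathbf 1_n$ for all $i$ the system has a trajectory $Q(t)$, $t\ge0$, and every such trajectory converges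 exponentially fast to an equilibrium: there are constants $c,\alpha>0$, depending only on $A$, $B$ and the weights $w_{ij}$, such that for every such trajectory there is an equilibrium $\bar Q$ of the system with $$\|Q(t)-\bar Q\|\le c\,\|Q(0)-\bar Q\|\,e^{-\alpha t}\quad\text{and}\quad \|P_i(t)-\Pi^*\|_F\le c\,\|Q(0)-\bar Q\|\,e^{-\alpha t}\qquad(t\ge 0,\ i=1,\dots,n),$$ where $\|\cdot\|$ is the Euclidean (Frobenius) norm. -/

import Mathlib

open scoped Matrix

/-- The Frobenius norm of a real matrix. -/
noncomputable def frobNorm {n : ℕ} (X : Matrix (Fin n) (Fin n) ℝ) : ℝ :=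
  Real.sqrt (∑ k, ∑ l, X k l ^ 2)

/-- A weighted undirected graph on the vertices `0, …, n-1`, given by its symmetric adjacency
matrix with nonnegative entries. -/
structure WeightedGraph (n : ℕ) where
  /-- The adjacency matrix. -/
  adj : Matrix (Fin n) (Fin n) ℝ
  symm : adj.IsSymm
  nonneg : ∀ i j, 0 ≤ adj i j

theorem WeightedGraph.isHermitian {n : ℕ} (G : WeightedGraph n) : G.adj.IsHermitian := by
  rw [Matrix.IsHermitian, Matrix.conjTranspose_eq_transpose_of_trivial]
  exact G.symm

/-- The set of `n × n` permutation matrices. -/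
def permMatrices (n : ℕ) : Set (Matrix (Fin n) (Fin n) ℝ) :=
  {M | (∀ i j, M i j = 0 ∨ M i j = 1) ∧ M *ᵥ 1 = 1 ∧ Mᵀ *ᵥ 1 = 1}

/-- The adjacency disagreement `‖A - Πᵀ B Π‖_F`. -/
noncomputable def distortion {n : ℕ} (G₁ G₂ : WeightedGraph n)
    (M : Matrix (Fin n) (Fin n) ℝ) : ℝ :=
  frobNorm (G₁.adj - Mᵀ * G₂.adj * M)

/-- The set of isomorphisms, as permutation matrices, matching `G₁` and `G₂`. -/
def isoSet {n : ℕ} (G₁ G₂ : WeightedGraph n) : Set (Matrix (Fin n) (Fin n) ℝ) :=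
  {M | M ∈ permMatrices n ∧ distortion G₁ G₂ M = 0}

/-- Two graphs are isomorphic if some permutation matrix has zero distortion. -/
def Isomorphic {n : ℕ} (G₁ G₂ : WeightedGraph n) : Prop :=
  (isoSet G₁ G₂).Nonempty

namespace WeightedGraph

/-- A graph is asymmetric if the identity is its only automorphism. -/
def Asymmetric {n : ℕ} (G : WeightedGraph n) : Prop :=
  ∀ M ∈ isoSet G G, M = 1

/-- A graph is friendly if its adjacency matrix has simple spectrum and none of its eigenvectors
is orthogonal to the all-ones vector. -/
def Friendly {n : ℕ} (G : WeightedGraph n) : Prop :=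
  Function.Injective G.isHermitian.eigenvalues ∧
    ∀ (u : Fin n → ℝ) (μ : ℝ), u ≠ 0 → G.adj *ᵥ u = μ • u → u ⬝ᵥ 1 ≠ 0

end WeightedGraph

/-- `w` is a family of symmetric edge weights on the interaction graph `H`: positive on the edges
and zero elsewhere. -/
structure IsEdgeWeight {n : ℕ} (H : SimpleGraph (Fin n)) (w : Fin n → Fin n → ℝ) : Prop where
  symm : ∀ i j, w i j = w j i
  pos : ∀ i j, H.Adj i j → 0 < w i j
  zero : ∀ i j, ¬ H.Adj i j → w i j = 0

/-- The set of pseudo-stochastic matrices, whose rows sum to one. -/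
def pseudoStochastic (n : ℕ) : Set (Matrix (Fin n) (Fin n) ℝ) :=
  {P | P *ᵥ 1 = 1}

/-- The projection `V ↦ V (I - (1/n) 1 1ᵀ)`. -/
noncomputable def projD {n : ℕ} (V : Matrix (Fin n) (Fin n) ℝ) : Matrix (Fin n) (Fin n) ℝ :=
  V * (1 - (1 / (n : ℝ)) • Matrix.vecMulVec 1 1)

/-- The joint state of the agents: for each agent `i`, the primal variables
`P i, y i, z i, K i` and the dual variables `lam i, Theta i, Upsilon i`. -/
@[ext]
structure NetState (n : ℕ) where
  P : Fin n → Matrix (Fin n) (Fin n) ℝ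
  y : Fin n → Fin n → ℝ
  z : Fin n → Fin n → ℝ
  K : Fin n → Matrix (Fin n) (Fin n) ℝ
  lam : Fin n → Fin n → ℝ
  Theta : Fin n → Matrix (Fin n) (Fin n) ℝ
  Upsilon : Fin n → Matrix (Fin n) (Fin n) ℝ

namespace NetState

variable {n : ℕ}

/-- The Euclidean (Frobenius) distance of two states. -/
noncomputable def eucDist (Q R : NetState n) : ℝ :=
  Real.sqrt
    ((∑ i, ∑ k, ∑ l, (Q.P i k l - R.P i k l) ^ 2)
      + (∑ i, ∑ k, (Q.y i k - R.y i k) ^ 2)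
      + (∑ i, ∑ k, (Q.z i k - R.z i k) ^ 2)
      + (∑ i, ∑ k, ∑ l, (Q.K i k l - R.K i k l) ^ 2)
      + (∑ i, ∑ k, (Q.lam i k - R.lam i k) ^ 2)
      + (∑ i, ∑ k, ∑ l, (Q.Theta i k l - R.Theta i k l) ^ 2)
      + (∑ i, ∑ k, ∑ l, (Q.Upsilon i k l - R.Upsilon i k l) ^ 2))

end NetState

/-- The disagreement `∑ⱼ wᵢⱼ (Xᵢ - Xⱼ)` of agent `i` with its neighbors. -/
def disagreement {n : ℕ} (w : Fin n → Fin n → ℝ)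
    (X : Fin n → Matrix (Fin n) (Fin n) ℝ) (i : Fin n) : Matrix (Fin n) (Fin n) ℝ :=
  ∑ j, w i j • (X i - X j)

/-- The matrix whose `i`th column is `v` and whose other columns vanish. -/
def onlyCol {n : ℕ} (i : Fin n) (v : Fin n → ℝ) : Matrix (Fin n) (Fin n) ℝ :=
  Matrix.of fun k l => if l = i then v k else 0

/-- The matrix whose `i`th row is `v` and whose other rows vanish. -/
def onlyRow {n : ℕ} (i : Fin n) (v : Fin n → ℝ) : Matrix (Fin n) (Fin n) ℝ :=
  Matrix.of fun k l => if k = i then v l else 0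

/-- The vector field of the distributed projected primal-dual algorithm, where agent `i` knows
the `i`th column `a i` of the first and the `i`th column `b i` of the second adjacency matrix. -/
noncomputable def algField {n : ℕ} (G₁ G₂ : WeightedGraph n) (w : Fin n → Fin n → ℝ)
    (Q : NetState n) : NetState n :=
  let a : Fin n → Fin n → ℝ := fun i k => G₁.adj k i
  let b : Fin n → Fin n → ℝ := fun i k => G₂.adj k i
  { P := fun i => projD
      (- Matrix.vecMulVec (Q.P i *ᵥ a i - Q.y i) (a i)
        - Matrix.vecMulVec (b i) (Q.lam i)
        - disagreement w Q.Theta i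
        - disagreement w Q.P i
        - Matrix.vecMulVec (b i) (b i ᵥ* Q.P i - Q.z i))
    y := fun i => (Q.P i *ᵥ a i - Q.y i) - fun k => Q.Upsilon i k i
    z := fun i => Q.lam i + (fun l => Q.Upsilon i i l) + (b i ᵥ* Q.P i - Q.z i)
    K := fun i => disagreement w Q.Upsilon i
    lam := fun i => b i ᵥ* Q.P i - Q.z i
    Theta := fun i => disagreement w Q.P i
    Upsilon := fun i => onlyCol i (Q.y i) - onlyRow i (Q.z i)
      - disagreement w Q.K i - disagreement w Q.Upsilon i }

/-- Entrywise, the curve `Q` has derivative `D` at the time `t`, relative to `[0, ∞)`. -/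
structure HasVelocity {n : ℕ} (Q : ℝ → NetState n) (D : NetState n) (t : ℝ) : Prop where
  P : ∀ i k l, HasDerivWithinAt (fun s => (Q s).P i k l) (D.P i k l) (Set.Ici 0) t
  y : ∀ i k, HasDerivWithinAt (fun s => (Q s).y i k) (D.y i k) (Set.Ici 0) t
  z : ∀ i k, HasDerivWithinAt (fun s => (Q s).z i k) (D.z i k) (Set.Ici 0) t
  K : ∀ i k l, HasDerivWithinAt (fun s => (Q s).K i k l) (D.K i k l) (Set.Ici 0) t
  lam : ∀ i k, HasDerivWithinAt (fun s => (Q s).lam i k) (D.lam i k) (Set.Ici 0) t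
  Theta : ∀ i k l,
    HasDerivWithinAt (fun s => (Q s).Theta i k l) (D.Theta i k l) (Set.Ici 0) t
  Upsilon : ∀ i k l,
    HasDerivWithinAt (fun s => (Q s).Upsilon i k l) (D.Upsilon i k l) (Set.Ici 0) t

/-- `Q₀` is an admissible initialization: all estimates `P i` are pseudo-stochastic. -/
def IsInitialState {n : ℕ} (Q₀ : NetState n) : Prop :=
  ∀ i, Q₀.P i ∈ pseudoStochastic n

/-- `Q` restricted to `[0, ∞)` is the trajectory of the algorithm with initial state `Q₀`. -/
def IsTrajectory {n : ℕ} (G₁ G₂ : WeightedGraph n) (w : Fin n → Fin n → ℝ) (Q₀ : NetState n)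
    (Q : ℝ → NetState n) : Prop :=
  Q 0 = Q₀ ∧ ∀ t : ℝ, 0 ≤ t → HasVelocity Q (algField G₁ G₂ w (Q t)) t

/-- `R` is an equilibrium of the algorithm: its velocity vanishes in every component. -/
def IsEquilibrium {n : ℕ} (G₁ G₂ : WeightedGraph n) (w : Fin n → Fin n → ℝ)
    (R : NetState n) : Prop :=
  algField G₁ G₂ w R = ⟨0, 0, 0, 0, 0, 0, 0⟩

/-!
The vector field `algField` is linear in the state, so every trajectory is an orbit of a linear
flow `exp (t M)`, and differences of admissible states lie in the subspace `S` on which each `P i`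
annihilates the all-ones vector; `M` maps into `S`.

On `S` the projection `projD` is invisible to the inner product and the primal-dual coupling is
skew, so `⟪x, M x⟫` is minus a sum of squares (`inner_algField`): the residuals `P i a i - y i` and
`b i P i - z i`, and the disagreements of `P` and `Upsilon`. The norm is therefore nonincreasing.
If it stays constant on `[0, 1]`, all these terms vanish along the whole orbit, where `M` is then
both skew and nilpotent (`toVec_algField_iterate_three_eq_zero`), so the orbit is a fixed point.
Thus the time-one flow strictly decreases the norm on the orthogonal complement of `ker M`, which
the flow preserves, and compactness of the unit sphere turns this into a contraction factor
`ρ < 1`. This gives exponential convergence to the orthogonal projection on `ker M`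
(`exists_exponential_decay`).

It remains to identify the limit. Every element of `ker M ∩ S` has a common estimate `P` with
`P A = B P` and `P 1 = 0`, as summing the `Upsilon`-equations over the agents shows. Friendliness
forces `P = 0` (`eq_zero_of_mul_adj_eq_adj_mul`), which also proves that the isomorphism is unique.
Conversely the isomorphism is the estimate of some equilibrium (`exists_isEquilibrium`), because
the Laplacian of the connected interaction graph attains every balanced family.
-/

/-! ### Dissipative linear flows -/

section DissipativeFlow

variable {E : Type*} [NormedAddCommGroup E] [InnerProductSpace ℝ E]

/-- Where the quadratic form of a dissipative operator vanishes, the operator is skew. -/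
theorem inner_map_eq_neg_of_inner_self_map_eq_zero {M : E →L[ℝ] E}
    (hd : ∀ x, inner ℝ x (M x) ≤ 0) {x : E} (hx : inner ℝ x (M x) = 0) (y : E) :
    inner ℝ x (M y) = -inner ℝ (M x) y := by
  have key : ∀ s : ℝ, s * (inner ℝ x (M y) + inner ℝ y (M x)) + s ^ 2 * inner ℝ y (M y) ≤ 0 := by
    intro s
    have h := hd (x + s • y)
    simp only [map_add, map_smul, inner_add_left, inner_add_right, inner_smul_left,
      inner_smul_right, conj_trivial, hx] at h
    linarith
  rw [real_inner_comm y (M x)]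
  set β := inner ℝ x (M y) + inner ℝ y (M x) with hβ
  have hγ := hd y
  set γ : ℝ := inner ℝ y (M y)
  have h1 : 0 < 1 - γ := by linarith
  have h2 := key (β / (1 - γ))
  have h3 : β / (1 - γ) * β + (β / (1 - γ)) ^ 2 * γ = (β / (1 - γ)) ^ 2 := by
    field_simp
    ring
  rw [h3] at h2
  have h4 : β / (1 - γ) = 0 := pow_eq_zero_iff (two_ne_zero) |>.1 (le_antisymm h2 (sq_nonneg _))
  have h5 : β = 0 := by
    rcases div_eq_zero_iff.1 h4 with h | h
    · exact h
    · linarith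
  linarith

/-- A dissipative operator that is nilpotent along a vector on whose orbit no energy is dissipated
annihilates that vector: it is both skew and nilpotent there. -/
theorem map_eq_zero_of_skew_of_pow_three {M : E →L[ℝ] E}
    (hd : ∀ x, inner ℝ x (M x) ≤ 0) {x : E}
    (hx : ∀ k : ℕ, inner ℝ ((M ^ k) x) (M ((M ^ k) x)) = 0) (h3 : (M ^ 3) x = 0) : M x = 0 := by
  have h1 : inner ℝ (M x) (M (M x)) = 0 := by simpa using hx 1
  have h2 : inner ℝ (M (M x)) (M (M (M x))) = 0 := by simpa [pow_succ] using hx 2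
  have h3' : M (M (M x)) = 0 := by simpa [pow_succ] using h3
  have h4 : M (M x) = 0 := by
    have := inner_map_eq_neg_of_inner_self_map_eq_zero hd h2 (M x)
    rw [h3', inner_zero_left, neg_zero] at this
    exact inner_self_eq_zero.1 this
  have := inner_map_eq_neg_of_inner_self_map_eq_zero hd h1 x
  rw [h4, inner_zero_left, neg_zero] at this
  exact inner_self_eq_zero.1 this

/-- The flow of the linear differential equation `u' = M u`. -/
noncomputable def linFlow (M : E →L[ℝ] E) (t : ℝ) : E →L[ℝ] E :=
  NormedSpace.exp (t • M)

@[simp]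
theorem linFlow_zero_apply (M : E →L[ℝ] E) (x : E) : linFlow M 0 x = x := by
  simp [linFlow]

variable [FiniteDimensional ℝ E]

theorem hasDerivAt_linFlow_apply (M : E →L[ℝ] E) (x : E) (t : ℝ) :
    HasDerivAt (fun s : ℝ => linFlow M s x) (M (linFlow M t x)) t := by
  have := FiniteDimensional.complete ℝ E
  have h := hasDerivAt_exp_smul_const' (𝕂 := ℝ) M t
  exact h.clm_apply (hasDerivAt_const t x) |>.congr_deriv (by simp [linFlow])

theorem linFlow_add_apply (M : E →L[ℝ] E) (s t : ℝ) (x : E) :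
    linFlow M (s + t) x = linFlow M s (linFlow M t x) := by
  have := FiniteDimensional.complete ℝ E
  let _ : NormedAlgebra ℚ (E →L[ℝ] E) := NormedAlgebra.restrictScalars ℚ ℝ _
  rw [linFlow, add_smul, NormedSpace.exp_add_of_commute]
  · rfl
  · exact ((Commute.refl M).smul_left s).smul_right t

theorem antitone_norm_sq_linFlow_apply {M : E →L[ℝ] E} (hd : ∀ x, inner ℝ x (M x) ≤ 0) (x : E) :
    Antitone fun s : ℝ => ‖linFlow M s x‖ ^ 2 := by
  have h : ∀ s, HasDerivAt (fun s : ℝ => ‖linFlow M s x‖ ^ 2)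
      (2 * inner ℝ (linFlow M s x) (M (linFlow M s x))) s :=
    fun s => (hasDerivAt_linFlow_apply M x s).norm_sq
  apply antitone_of_deriv_nonpos
  · exact fun s => (h s).differentiableAt
  · intro s
    rw [(h s).deriv]
    have := hd (linFlow M s x)
    linarith

/-- If the norm does not decrease on `[0, 1]`, then no energy is dissipated along the orbit of `x`
under `M`: differentiate the vanishing dissipation repeatedly. -/
theorem inner_pow_map_eq_zero_of_norm_le_norm_linFlow_one {M : E →L[ℝ] E}
    (hd : ∀ x, inner ℝ x (M x) ≤ 0) {x : E} (hx : ‖x‖ ≤ ‖linFlow M 1 x‖) (k : ℕ) :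
    inner ℝ ((M ^ k) x) (M ((M ^ k) x)) = 0 := by
  set u : ℝ → E := fun s => linFlow M s x with hu
  have hanti := antitone_norm_sq_linFlow_apply hd x
  have hconst : ∀ s ∈ Set.Icc (0 : ℝ) 1, ‖u s‖ ^ 2 = ‖x‖ ^ 2 := by
    intro s hs
    apply le_antisymm
    · simpa using hanti hs.1
    · refine le_trans ?_ (hanti hs.2)
      simpa using pow_le_pow_left₀ (norm_nonneg x) hx 2
  have hdiff : ∀ s ∈ Set.Icc (0 : ℝ) 1, ∀ (f : ℝ → ℝ) (f' : ℝ) (c : ℝ),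
      (∀ s ∈ Set.Icc (0 : ℝ) 1, f s = c) → HasDerivAt f f' s → f' = 0 := by
    intro s hs f f' c hf hf'
    have h1 : HasDerivWithinAt f 0 (Set.Icc 0 1) s :=
      (hasDerivWithinAt_const s (Set.Icc (0 : ℝ) 1) c).congr hf (hf s hs)
    exact (uniqueDiffOn_Icc zero_lt_one s hs).eq_deriv _ hf'.hasDerivWithinAt h1
  have hq : ∀ s ∈ Set.Icc (0 : ℝ) 1, inner ℝ (u s) (M (u s)) = 0 := by
    intro s hs
    have := hdiff s hs _ _ _ hconst (hasDerivAt_linFlow_apply M x s).norm_sq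
    linarith
  have hk : ∀ k : ℕ, ∀ s ∈ Set.Icc (0 : ℝ) 1, ∀ y,
      inner ℝ ((M ^ k) (u s)) (M y) + inner ℝ ((M ^ (k + 1)) (u s)) y = 0 := by
    intro k
    induction k with
    | zero =>
      intro s hs y
      have := inner_map_eq_neg_of_inner_self_map_eq_zero hd (hq s hs) y
      simp [this]
    | succ k ih =>
      intro s hs y
      have hpow : ∀ j : ℕ, HasDerivAt (fun s => (M ^ j) (u s)) ((M ^ (j + 1)) (u s)) s := by
        intro j
        have := (M ^ j).hasFDerivAt.comp_hasDerivAt s (hasDerivAt_linFlow_apply M x s)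
        rw [pow_succ]
        exact this
      have h := ((hpow k).inner ℝ (hasDerivAt_const s (M y))).add
        ((hpow (k + 1)).inner ℝ (hasDerivAt_const s y))
      have := hdiff s hs _ _ 0 (fun s hs => ih s hs y) h
      simpa using this
  have h0 := hk k 0 ⟨le_rfl, zero_le_one⟩ ((M ^ k) x)
  have hu0 : u 0 = x := by simp [hu]
  rw [hu0, pow_succ', mul_apply_eq_comp, real_inner_comm] at h0
  rw [real_inner_comm] at h0 ⊢
  rw [real_inner_comm] at h0
  linarith

/-- The kernel of `M` is orthogonal to the range of `M`, so the flow preserves the orthogonal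
complement of the kernel. -/
theorem linFlow_apply_mem_orthogonal_ker {M : E →L[ℝ] E} (hd : ∀ x, inner ℝ x (M x) ≤ 0)
    {x : E} (hx : x ∈ (M.toLinearMap.ker)ᗮ) (t : ℝ) :
    linFlow M t x ∈ (M.toLinearMap.ker)ᗮ := by
  rw [Submodule.mem_orthogonal] at hx ⊢
  intro k hk
  have hk' : M k = 0 := hk
  have hder : ∀ s, HasDerivAt (fun s : ℝ => inner ℝ k (linFlow M s x)) 0 s := by
    intro s
    refine ((hasDerivAt_const s k).inner ℝ (hasDerivAt_linFlow_apply M x s)).congr_deriv ?_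
    rw [inner_map_eq_neg_of_inner_self_map_eq_zero hd (by rw [hk', inner_zero_right]), hk']
    simp
  have := is_const_of_deriv_eq_zero (fun s => (hder s).differentiableAt)
    (fun s => (hder s).deriv) t 0
  rw [this, linFlow_zero_apply]
  exact hx k hk

theorem linFlow_apply_of_map_eq_zero {M : E →L[ℝ] E} {k : E} (hk : M k = 0) (t : ℝ) :
    linFlow M t k = k := by
  have := FiniteDimensional.complete ℝ E
  have hder : ∀ s, HasDerivAt (fun s : ℝ => linFlow M s k) 0 s := by
    intro s
    have h := (hasDerivAt_exp_smul_const (𝕂 := ℝ) M s).clm_apply (hasDerivAt_const s k)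
    exact h.congr_deriv (by simp [hk])
  have := is_const_of_deriv_eq_zero (fun s => (hder s).differentiableAt)
    (fun s => (hder s).deriv) t 0
  rw [this, linFlow_zero_apply]

/-- The time-one flow is a uniform contraction on the orthogonal complement of the kernel. It
strictly decreases every nonzero norm there, and the unit sphere is compact. -/
theorem exists_contraction_linFlow_one {M : E →L[ℝ] E} (hd : ∀ x, inner ℝ x (M x) ≤ 0)
    (h3 : ∀ x, (∀ k : ℕ, inner ℝ ((M ^ k) x) (M ((M ^ k) x)) = 0) → (M ^ 3) x = 0) :
    ∃ ρ : ℝ, 0 < ρ ∧ ρ < 1 ∧ ∀ x ∈ (M.toLinearMap.ker)ᗮ, ‖linFlow M 1 x‖ ≤ ρ * ‖x‖ := by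
  have := FiniteDimensional.proper ℝ E
  set W := (M.toLinearMap.ker)ᗮ with hW
  have hstrict : ∀ x ∈ W, x ≠ 0 → ‖linFlow M 1 x‖ < ‖x‖ := by
    intro x hxW hx0
    by_contra! hle
    have hk := inner_pow_map_eq_zero_of_norm_le_norm_linFlow_one hd hle
    have hker : M x = 0 := map_eq_zero_of_skew_of_pow_three hd hk (h3 x hk)
    exact hx0 (inner_self_eq_zero (𝕜 := ℝ).1 ((Submodule.mem_orthogonal _ _).1 hxW x hker))
  have hcomp : IsCompact (Metric.sphere (0 : E) 1 ∩ (W : Set E)) :=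
    (isCompact_sphere _ _).inter_right (Submodule.closed_of_finiteDimensional W)
  have hunit : ∃ ρ : ℝ, 0 < ρ ∧ ρ < 1 ∧
      ∀ x ∈ Metric.sphere (0 : E) 1 ∩ (W : Set E), ‖linFlow M 1 x‖ ≤ ρ := by
    rcases (Metric.sphere (0 : E) 1 ∩ (W : Set E)).eq_empty_or_nonempty with he | hne
    · exact ⟨1 / 2, by norm_num, by norm_num, fun x hx => by simp [he] at hx⟩
    · obtain ⟨x₀, hx₀, hmax⟩ := hcomp.exists_isMaxOn hne
        (f := fun x => ‖linFlow M 1 x‖)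
        ((linFlow M 1).continuous.norm.continuousOn)
      have hn : ‖x₀‖ = 1 := by simpa using hx₀.1
      have hlt := hstrict x₀ hx₀.2 (by rintro rfl; simp at hn)
      rw [hn] at hlt
      exact ⟨max (1 / 2) ‖linFlow M 1 x₀‖, by positivity, max_lt (by norm_num) hlt,
        fun x hx => (hmax hx).trans (le_max_right _ _)⟩
  obtain ⟨ρ, hρ0, hρ1, hρ⟩ := hunit
  refine ⟨ρ, hρ0, hρ1, fun x hx => ?_⟩
  rcases eq_or_ne x 0 with rfl | hx0
  · simp
  have hn : 0 < ‖x‖ := norm_pos_iff.2 hx0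
  have := hρ (‖x‖⁻¹ • x) ⟨by simp [norm_smul, hn.ne'], W.smul_mem _ hx⟩
  rw [map_smul, norm_smul, norm_inv, norm_norm, inv_mul_le_iff₀ hn] at this
  linarith

/-- A dissipative linear flow whose operator is nilpotent wherever no energy is dissipated
converges exponentially to a zero of the operator, namely the orthogonal projection of the
initial value on the kernel. -/
theorem exists_exponential_decay {M : E →L[ℝ] E} (hd : ∀ x, inner ℝ x (M x) ≤ 0)
    (h3 : ∀ x, (∀ k : ℕ, inner ℝ ((M ^ k) x) (M ((M ^ k) x)) = 0) → (M ^ 3) x = 0) :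
    ∃ c > (0 : ℝ), ∃ α > (0 : ℝ), ∀ x, ∃ k, M k = 0 ∧ ∀ t : ℝ, 0 ≤ t →
      ‖linFlow M t x - k‖ ≤ c * ‖x - k‖ * Real.exp (-α * t) := by
  obtain ⟨ρ, hρ0, hρ1, hρ⟩ := exists_contraction_linFlow_one hd h3
  have hpow : ∀ (m : ℕ), ∀ x ∈ (M.toLinearMap.ker)ᗮ,
      ‖linFlow M m x‖ ≤ ρ ^ m * ‖x‖ := by
    intro m x hx
    induction m with
    | zero => simp
    | succ m ih =>
      have h1 := hρ _ (linFlow_apply_mem_orthogonal_ker hd hx m)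
      have h2 := linFlow_add_apply M 1 m x
      rw [Nat.cast_succ, add_comm, h2, pow_succ']
      nlinarith
  refine ⟨ρ⁻¹, inv_pos.2 hρ0, -Real.log ρ, neg_pos.2 (Real.log_neg hρ0 hρ1), fun x => ?_⟩
  obtain ⟨k, hk, w, hw, rfl⟩ := M.toLinearMap.ker.exists_add_mem_mem_orthogonal x
  refine ⟨k, hk, fun t ht => ?_⟩
  rw [map_add, linFlow_apply_of_map_eq_zero hk, add_sub_cancel_left, add_sub_cancel_left]
  have h1 : ‖linFlow M t w‖ ≤ ‖linFlow M ⌊t⌋₊ w‖ :=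
    (sq_le_sq₀ (norm_nonneg _) (norm_nonneg _)).1
      (antitone_norm_sq_linFlow_apply hd w (Nat.floor_le ht))
  -- `ρ ^ ⌊t⌋ ≤ ρ ^ (t - 1)`, which accounts for the constant `ρ⁻¹`.
  have h2 : ρ ^ ⌊t⌋₊ ≤ ρ⁻¹ * Real.exp (-(-Real.log ρ) * t) := by
    rw [neg_neg, ← Real.rpow_def_of_pos hρ0, ← Real.rpow_natCast, ← Real.rpow_neg_one,
      ← Real.rpow_add hρ0]
    exact Real.rpow_le_rpow_of_exponent_ge hρ0 hρ1.le (by linarith [Nat.lt_floor_add_one t])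
  calc _ ≤ ρ ^ ⌊t⌋₊ * ‖w‖ := h1.trans (hpow _ w hw)
    _ ≤ ρ⁻¹ * Real.exp (-(-Real.log ρ) * t) * ‖w‖ := by gcongr
    _ = _ := by ring

/-- Solutions of a linear equation on `[0, ∞)` are given by the flow. -/
theorem eq_linFlow_apply_of_hasDerivWithinAt {M : E →L[ℝ] E} {u : ℝ → E}
    (hu : ∀ t, 0 ≤ t → HasDerivWithinAt u (M (u t)) (Set.Ici 0) t) {t : ℝ} (ht : 0 ≤ t) :
    u t = linFlow M t (u 0) := by
  have hc : ContinuousOn u (Set.Icc 0 t) := fun s hs =>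
    (hu s hs.1).continuousWithinAt.mono fun r hr => hr.1
  refine ODE_solution_unique (v := fun _ => M) (K := ‖M‖₊) (fun _ => M.lipschitz) hc
    (fun s hs => (hu s hs.1).mono (Set.Ici_subset_Ici.2 hs.1))
    (g := fun s => linFlow M s (u 0)) ?_
    (fun s _ => (hasDerivAt_linFlow_apply M (u 0) s).hasDerivWithinAt) (by simp) ⟨ht, le_rfl⟩
  exact fun s _ => (hasDerivAt_linFlow_apply M (u 0) s).continuousAt.continuousWithinAt

end DissipativeFlow

/-! ### The Frobenius inner product and the projection -/

section FrobeniusInner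

variable {n : ℕ}

/-- The Frobenius inner product of two real matrices. -/
def frobInner (X Y : Matrix (Fin n) (Fin n) ℝ) : ℝ :=
  ∑ k, ∑ l, X k l * Y k l

theorem frobInner_comm (X Y : Matrix (Fin n) (Fin n) ℝ) : frobInner X Y = frobInner Y X := by
  simp only [frobInner, mul_comm]

theorem frobInner_add_right (X Y Z : Matrix (Fin n) (Fin n) ℝ) :
    frobInner X (Y + Z) = frobInner X Y + frobInner X Z := by
  simp [frobInner, mul_add, Finset.sum_add_distrib]

theorem frobInner_neg_right (X Y : Matrix (Fin n) (Fin n) ℝ) :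
    frobInner X (-Y) = -frobInner X Y := by
  simp [frobInner]

theorem frobInner_sub_right (X Y Z : Matrix (Fin n) (Fin n) ℝ) :
    frobInner X (Y - Z) = frobInner X Y - frobInner X Z := by
  rw [sub_eq_add_neg, frobInner_add_right, frobInner_neg_right, ← sub_eq_add_neg]

theorem frobInner_smul_right (c : ℝ) (X Y : Matrix (Fin n) (Fin n) ℝ) :
    frobInner X (c • Y) = c * frobInner X Y := by
  simp [frobInner, Finset.mul_sum, mul_left_comm]

theorem frobInner_sum_right {ι : Type*} (s : Finset ι) (X : Matrix (Fin n) (Fin n) ℝ)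
    (Y : ι → Matrix (Fin n) (Fin n) ℝ) :
    frobInner X (∑ j ∈ s, Y j) = ∑ j ∈ s, frobInner X (Y j) := by
  induction s using Finset.cons_induction with
  | empty => simp [frobInner]
  | cons a s ha ih => rw [Finset.sum_cons, Finset.sum_cons, frobInner_add_right, ih]

theorem frobInner_self_nonneg (X : Matrix (Fin n) (Fin n) ℝ) : 0 ≤ frobInner X X :=
  Finset.sum_nonneg fun _ _ => Finset.sum_nonneg fun _ _ => mul_self_nonneg _

theorem frobInner_self_eq_zero {X : Matrix (Fin n) (Fin n) ℝ} (h : frobInner X X = 0) : X = 0 := by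
  ext k l
  have h1 := (Finset.sum_eq_zero_iff_of_nonneg fun k _ =>
    Finset.sum_nonneg fun l _ => mul_self_nonneg (X k l)).1 h k (Finset.mem_univ k)
  have h2 := (Finset.sum_eq_zero_iff_of_nonneg fun l _ => mul_self_nonneg (X k l)).1 h1 l
    (Finset.mem_univ l)
  exact mul_self_eq_zero.1 h2

theorem frobInner_vecMulVec (X : Matrix (Fin n) (Fin n) ℝ) (u v : Fin n → ℝ) :
    frobInner X (Matrix.vecMulVec u v) = u ⬝ᵥ (X *ᵥ v) := by
  simp only [frobInner, Matrix.vecMulVec_apply, dotProduct, Matrix.mulVec, Finset.mul_sum]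
  exact Finset.sum_congr rfl fun k _ => Finset.sum_congr rfl fun l _ => by ring

theorem frobInner_vecMulVec' (X : Matrix (Fin n) (Fin n) ℝ) (u v : Fin n → ℝ) :
    frobInner X (Matrix.vecMulVec u v) = (u ᵥ* X) ⬝ᵥ v := by
  rw [frobInner_vecMulVec, Matrix.dotProduct_mulVec]

theorem frobInner_onlyCol (X : Matrix (Fin n) (Fin n) ℝ) (i : Fin n) (v : Fin n → ℝ) :
    frobInner X (onlyCol i v) = v ⬝ᵥ fun k => X k i := by
  simp [frobInner, onlyCol, dotProduct, mul_comm]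

theorem frobInner_onlyRow (X : Matrix (Fin n) (Fin n) ℝ) (i : Fin n) (v : Fin n → ℝ) :
    frobInner X (onlyRow i v) = v ⬝ᵥ X i := by
  simp [frobInner, onlyRow, dotProduct, mul_comm]

theorem projD_eq_sub (V : Matrix (Fin n) (Fin n) ℝ) :
    projD V = V - Matrix.vecMulVec ((1 / (n : ℝ)) • (V *ᵥ 1)) 1 := by
  rw [projD, mul_sub, mul_one, Matrix.mul_smul, Matrix.mul_vecMulVec, Matrix.smul_vecMulVec]

theorem projD_mulVec_one (V : Matrix (Fin n) (Fin n) ℝ) : projD V *ᵥ 1 = 0 := by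
  rw [projD_eq_sub, Matrix.sub_mulVec, Matrix.vecMulVec_mulVec]
  rcases Nat.eq_zero_or_pos n with rfl | hn
  · exact Subsingleton.elim _ _
  ext k
  have : (n : ℝ) ≠ 0 := by positivity
  simp
  field_simp
  simp

/-- `projD` is the orthogonal projection onto the matrices that annihilate the all-ones vector. -/
theorem frobInner_projD {X : Matrix (Fin n) (Fin n) ℝ} (hX : X *ᵥ 1 = 0)
    (V : Matrix (Fin n) (Fin n) ℝ) : frobInner X (projD V) = frobInner X V := by
  rw [projD_eq_sub, frobInner_sub_right, frobInner_vecMulVec, hX, dotProduct_zero, sub_zero]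

theorem projD_add (V W : Matrix (Fin n) (Fin n) ℝ) : projD (V + W) = projD V + projD W := by
  rw [projD, add_mul]; rfl

theorem projD_smul (c : ℝ) (V : Matrix (Fin n) (Fin n) ℝ) : projD (c • V) = c • projD V := by
  rw [projD, Matrix.smul_mul]; rfl

theorem projD_zero : projD (0 : Matrix (Fin n) (Fin n) ℝ) = 0 := by
  rw [projD, zero_mul]

end FrobeniusInner

/-! ### The Laplacian of the interaction graph -/

section Disagreement

variable {n : ℕ} {w : Fin n → Fin n → ℝ}

theorem disagreement_add (X Y : Fin n → Matrix (Fin n) (Fin n) ℝ) (i : Fin n) :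
    disagreement w (X + Y) i = disagreement w X i + disagreement w Y i := by
  simp only [disagreement, ← Finset.sum_add_distrib, ← smul_add, Pi.add_apply]
  exact Finset.sum_congr rfl fun j _ => by congr 1; abel

theorem disagreement_smul (c : ℝ) (X : Fin n → Matrix (Fin n) (Fin n) ℝ) (i : Fin n) :
    disagreement w (c • X) i = c • disagreement w X i := by
  simp only [disagreement, Finset.smul_sum, Pi.smul_apply, ← smul_sub]
  exact Finset.sum_congr rfl fun j _ => smul_comm _ _ _

theorem disagreement_eq_zero_of_forall_eq {X : Fin n → Matrix (Fin n) (Fin n) ℝ}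
    (hX : ∀ i j, X i = X j) (i : Fin n) : disagreement w X i = 0 :=
  Finset.sum_eq_zero fun j _ => by rw [hX i j, sub_self, smul_zero]

theorem sum_disagreement (hw : ∀ i j, w i j = w j i) (X : Fin n → Matrix (Fin n) (Fin n) ℝ) :
    ∑ i, disagreement w X i = 0 := by
  have h : ∑ i, disagreement w X i = -∑ i, disagreement w X i := by
    conv_rhs => simp only [disagreement]
    rw [Finset.sum_comm, ← Finset.sum_neg_distrib]
    refine Finset.sum_congr rfl fun i _ => ?_
    rw [disagreement, ← Finset.sum_neg_distrib]
    refine Finset.sum_congr rfl fun j _ => ?_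
    rw [← smul_neg, neg_sub, hw]
  ext k l
  have := congr_fun₂ h k l
  rw [Matrix.neg_apply] at this
  rw [Matrix.zero_apply]
  linarith

/-- Summation by parts for the weighted graph Laplacian. -/
theorem sum_frobInner_disagreement (hw : ∀ i j, w i j = w j i)
    (X Y : Fin n → Matrix (Fin n) (Fin n) ℝ) :
    ∑ i, frobInner (X i) (disagreement w Y i) =
      (1 / 2) * ∑ i, ∑ j, w i j * frobInner (X i - X j) (Y i - Y j) := by
  have h1 : ∑ i, frobInner (X i) (disagreement w Y i) =
      ∑ i, ∑ j, w i j * frobInner (X i) (Y i - Y j) := by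
    simp only [disagreement, frobInner_sum_right, frobInner_smul_right]
  have h2 : ∑ i, ∑ j, w i j * frobInner (X i) (Y i - Y j) =
      -∑ i, ∑ j, w i j * frobInner (X j) (Y i - Y j) := by
    rw [Finset.sum_comm, ← Finset.sum_neg_distrib]
    refine Finset.sum_congr rfl fun i _ => ?_
    rw [← Finset.sum_neg_distrib]
    refine Finset.sum_congr rfl fun j _ => ?_
    rw [hw j i, ← neg_sub (Y i), frobInner_neg_right, mul_neg]
  have h3 : ∑ i, ∑ j, w i j * frobInner (X i - X j) (Y i - Y j) =
      ∑ i, ∑ j, w i j * frobInner (X i) (Y i - Y j) -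
        ∑ i, ∑ j, w i j * frobInner (X j) (Y i - Y j) := by
    simp only [← Finset.sum_sub_distrib, ← mul_sub]
    refine Finset.sum_congr rfl fun i _ => Finset.sum_congr rfl fun j _ => ?_
    rw [frobInner_comm, frobInner_sub_right, frobInner_comm, frobInner_comm _ (X j)]
  rw [h3, h1]
  linarith

theorem sum_frobInner_disagreement_comm (hw : ∀ i j, w i j = w j i)
    (X Y : Fin n → Matrix (Fin n) (Fin n) ℝ) :
    ∑ i, frobInner (X i) (disagreement w Y i) = ∑ i, frobInner (Y i) (disagreement w X i) := by
  simp only [sum_frobInner_disagreement hw, frobInner_comm]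

variable {H : SimpleGraph (Fin n)}

theorem IsEdgeWeight.nonneg (hw : IsEdgeWeight H w) (i j : Fin n) : 0 ≤ w i j := by
  by_cases h : H.Adj i j
  · exact (hw.pos i j h).le
  · exact (hw.zero i j h).ge

theorem sum_frobInner_disagreement_self_nonneg (hw : IsEdgeWeight H w)
    (X : Fin n → Matrix (Fin n) (Fin n) ℝ) : 0 ≤ ∑ i, frobInner (X i) (disagreement w X i) := by
  rw [sum_frobInner_disagreement hw.symm]
  exact mul_nonneg (by norm_num) (Finset.sum_nonneg fun i _ => Finset.sum_nonneg fun j _ =>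
    mul_nonneg (hw.nonneg i j) (frobInner_self_nonneg _))

/-- Over a connected graph, only consensus has vanishing disagreement energy. -/
theorem forall_eq_of_sum_frobInner_disagreement_eq_zero (hH : H.Connected)
    (hw : IsEdgeWeight H w) {X : Fin n → Matrix (Fin n) (Fin n) ℝ}
    (hX : ∑ i, frobInner (X i) (disagreement w X i) = 0) (i j : Fin n) : X i = X j := by
  rw [sum_frobInner_disagreement hw.symm] at hX
  have hX' := (mul_eq_zero.1 hX).resolve_left (by norm_num)
  have hnn : ∀ i j, 0 ≤ w i j * frobInner (X i - X j) (X i - X j) := fun i j =>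
    mul_nonneg (hw.nonneg i j) (frobInner_self_nonneg _)
  have hadj : ∀ i j, H.Adj i j → X i = X j := by
    intro i j hij
    have h1 := (Finset.sum_eq_zero_iff_of_nonneg fun i _ =>
      Finset.sum_nonneg fun j _ => hnn i j).1 hX' i (Finset.mem_univ i)
    have h2 := (Finset.sum_eq_zero_iff_of_nonneg fun j _ => hnn i j).1 h1 j (Finset.mem_univ j)
    exact sub_eq_zero.1 (frobInner_self_eq_zero
      ((mul_eq_zero.1 h2).resolve_left (hw.pos i j hij).ne'))
  obtain ⟨p⟩ := hH.preconnected i j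
  induction p with
  | nil => rfl
  | cons h _ ih => exact (hadj _ _ h).trans ih

/-- The Laplacian of a connected weighted graph attains every balanced family: it is symmetric
with respect to the Euclidean inner product and its kernel consists of the constant families. -/
theorem exists_disagreement_eq (hH : H.Connected) (hw : IsEdgeWeight H w)
    (R : Fin n → Matrix (Fin n) (Fin n) ℝ) (hR : ∑ i, R i = 0) :
    ∃ K : Fin n → Matrix (Fin n) (Fin n) ℝ, ∀ i, disagreement w K i = R i := by
  let T : EuclideanSpace ℝ (Fin n × Fin n × Fin n) →ₗ[ℝ]
      EuclideanSpace ℝ (Fin n × Fin n × Fin n) :=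
    { toFun := fun v => WithLp.toLp 2 fun p =>
        disagreement w (fun i => Matrix.of fun k l => v (i, k, l)) p.1 p.2.1 p.2.2
      map_add' := fun u v => by
        ext p
        exact congr_fun₂ (disagreement_add (w := w) (fun i => Matrix.of fun k l => u (i, k, l))
          (fun i => Matrix.of fun k l => v (i, k, l)) p.1) p.2.1 p.2.2
      map_smul' := fun c v => by
        ext p
        exact congr_fun₂ (disagreement_smul (w := w) c (fun i => Matrix.of fun k l => v (i, k, l))
          p.1) p.2.1 p.2.2 }
  have hin : ∀ u v, inner ℝ u (T v) = ∑ i, frobInner (Matrix.of fun k l => u (i, k, l))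
      (disagreement w (fun i => Matrix.of fun k l => v (i, k, l)) i) := by
    intro u v
    simp only [PiLp.inner_apply, Fintype.sum_prod_type, frobInner]
    refine Finset.sum_congr rfl fun i _ => Finset.sum_congr rfl fun k _ =>
      Finset.sum_congr rfl fun l _ => ?_
    exact mul_comm _ _
  have hsymm : T.IsSymmetric := by
    intro u v
    rw [real_inner_comm, hin, hin]
    exact sum_frobInner_disagreement_comm hw.symm _ _
  have hmem : WithLp.toLp 2 (fun p : Fin n × Fin n × Fin n => R p.1 p.2.1 p.2.2) ∈ T.range := by
    rw [← Submodule.orthogonal_orthogonal T.range, hsymm.orthogonal_range,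
      Submodule.mem_orthogonal]
    intro u hu
    have hcons := forall_eq_of_sum_frobInner_disagreement_eq_zero hH hw
      (X := fun i => Matrix.of fun k l => u (i, k, l))
      (by rw [← hin, LinearMap.mem_ker.1 hu, inner_zero_right])
    obtain ⟨i₀⟩ := hH.nonempty
    have : inner ℝ u (WithLp.toLp 2 (fun p : Fin n × Fin n × Fin n => R p.1 p.2.1 p.2.2)) =
        ∑ i, frobInner (Matrix.of fun k l => u (i₀, k, l)) (R i) := by
      simp only [PiLp.inner_apply, Fintype.sum_prod_type, frobInner]
      refine Finset.sum_congr rfl fun i _ => Finset.sum_congr rfl fun k _ =>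
        Finset.sum_congr rfl fun l _ => ?_
      have h := congr_fun₂ (hcons i i₀) k l
      simp only [Matrix.of_apply] at h ⊢
      rw [← h]
      exact mul_comm _ _
    rw [this, ← frobInner_sum_right, hR]
    simp [frobInner]
  obtain ⟨v, hv⟩ := hmem
  refine ⟨fun i => Matrix.of fun k l => v (i, k, l), fun i => ?_⟩
  ext k l
  exact congr_fun (congr_arg WithLp.ofLp hv) (i, k, l)

end Disagreement

/-! ### Graph isomorphisms and intertwiners -/

section Permutations

variable {n : ℕ}

theorem frobNorm_eq_sqrt (X : Matrix (Fin n) (Fin n) ℝ) :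
    frobNorm X = Real.sqrt (frobInner X X) := by
  simp only [frobNorm, frobInner, sq]

/-- Permutation matrices are orthogonal. -/
theorem transpose_mul_self_of_mem_permMatrices {M : Matrix (Fin n) (Fin n) ℝ}
    (hM : M ∈ permMatrices n) : Mᵀ * M = 1 := by
  obtain ⟨h01, hrow, hcol⟩ := hM
  have hsq : ∀ i j, M i j * M i j = M i j := fun i j => by
    rcases h01 i j with h | h <;> simp [h]
  have hrow' : ∀ i, ∑ j, M i j = 1 := fun i => by
    simpa [Matrix.mulVec, dotProduct] using congr_fun hrow i
  have hcol' : ∀ j, ∑ i, M i j = 1 := fun j => by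
    simpa [Matrix.mulVec, dotProduct] using congr_fun hcol j
  have hnn : ∀ i j, 0 ≤ M i j := fun i j => by rcases h01 i j with h | h <;> simp [h]
  ext j k
  rw [Matrix.mul_apply]
  simp only [Matrix.transpose_apply]
  rcases eq_or_ne j k with rfl | hjk
  · simp only [hsq, hcol', Matrix.one_apply_eq]
  · rw [Matrix.one_apply_ne hjk]
    refine Finset.sum_eq_zero fun i _ => ?_
    have hle : M i j + M i k ≤ 1 := by
      rw [← hrow' i, ← Finset.sum_pair hjk]
      exact Finset.sum_le_sum_of_subset_of_nonneg (Finset.subset_univ _) fun l _ _ => hnn i l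
    rcases h01 i j with h | h <;> rcases h01 i k with h' | h' <;> simp [h, h'] at hle ⊢
    norm_num at hle

theorem mul_adj_eq_adj_mul_of_mem_isoSet {G₁ G₂ : WeightedGraph n}
    {M : Matrix (Fin n) (Fin n) ℝ} (hM : M ∈ isoSet G₁ G₂) : M * G₁.adj = G₂.adj * M := by
  have h1 : G₁.adj - Mᵀ * G₂.adj * M = 0 := by
    apply frobInner_self_eq_zero
    have := hM.2
    rw [distortion, frobNorm_eq_sqrt] at this
    exact (Real.sqrt_eq_zero (frobInner_self_nonneg _)).1 this
  have h2 : M * Mᵀ = 1 := mul_eq_one_comm.1 (transpose_mul_self_of_mem_permMatrices hM.1)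
  rw [sub_eq_zero.1 h1, ← mul_assoc, ← mul_assoc, h2, one_mul]

/-- An intertwiner of two adjacency matrices that kills the all-ones vector vanishes if no
eigenvector of the first matrix is orthogonal to that vector. For an eigenvector `u`, the vector
`Pᵀ P u` satisfies the same eigenvector equation and is orthogonal to the all-ones vector, so it
is zero and hence `P u = 0`. -/
theorem eq_zero_of_mul_adj_eq_adj_mul {G₁ G₂ : WeightedGraph n} (hG : G₁.Friendly)
    {P : Matrix (Fin n) (Fin n) ℝ} (hP : P * G₁.adj = G₂.adj * P) (h1 : P *ᵥ 1 = 0) : P = 0 := by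
  have hT : G₁.adj * Pᵀ = Pᵀ * G₂.adj := by
    have := congr_arg Matrix.transpose hP
    rwa [Matrix.transpose_mul, Matrix.transpose_mul, G₁.symm.eq, G₂.symm.eq] at this
  have heig : ∀ (u : Fin n → ℝ) (μ : ℝ), G₁.adj *ᵥ u = μ • u → P *ᵥ u = 0 := by
    intro u μ hu
    have hw : Pᵀ *ᵥ (P *ᵥ u) = 0 := by
      by_contra hne
      refine hG.2 (Pᵀ *ᵥ (P *ᵥ u)) μ hne ?_ ?_
      · rw [Matrix.mulVec_mulVec, hT, ← Matrix.mulVec_mulVec, Matrix.mulVec_mulVec _ G₂.adj,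
          ← hP, ← Matrix.mulVec_mulVec, hu, Matrix.mulVec_smul, Matrix.mulVec_smul]
      · rw [Matrix.mulVec_transpose, ← Matrix.dotProduct_mulVec, h1, dotProduct_zero]
    have : (P *ᵥ u) ⬝ᵥ (P *ᵥ u) = 0 := by
      rw [Matrix.dotProduct_mulVec, ← Matrix.mulVec_transpose, hw, zero_dotProduct]
    exact dotProduct_self_eq_zero.1 this
  have hlin : Matrix.toEuclideanLin P = 0 := by
    refine G₁.isHermitian.eigenvectorBasis.toBasis.ext fun j => ?_
    have := heig _ _ (G₁.isHermitian.mulVec_eigenvectorBasis j)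
    simp [Matrix.toLpLin_apply, this]
  simpa using hlin

/-- Two isomorphisms differ by an intertwiner that kills the all-ones vector. -/
theorem subsingleton_isoSet {G₁ G₂ : WeightedGraph n} (hG : G₁.Friendly) :
    (isoSet G₁ G₂).Subsingleton := by
  intro M hM N hN
  refine sub_eq_zero.1 (eq_zero_of_mul_adj_eq_adj_mul (G₂ := G₂) hG ?_ ?_)
  · rw [sub_mul, mul_sub, mul_adj_eq_adj_mul_of_mem_isoSet hM,
      mul_adj_eq_adj_mul_of_mem_isoSet hN]
  · rw [Matrix.sub_mulVec, hM.1.2.1, hN.1.2.1, sub_self]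

end Permutations

/-! ### The Euclidean space of states -/

section Coordinates

variable {n : ℕ}

/-- The scalar coordinates of a state, in the order of the fields of `NetState`. -/
abbrev StateIndex (n : ℕ) : Type :=
  (Fin n × Fin n × Fin n) ⊕ (Fin n × Fin n) ⊕ (Fin n × Fin n) ⊕ (Fin n × Fin n × Fin n) ⊕
    (Fin n × Fin n) ⊕ (Fin n × Fin n × Fin n) ⊕ (Fin n × Fin n × Fin n)

/-- The Euclidean space of states. -/
abbrev StateSpace (n : ℕ) : Type := EuclideanSpace ℝ (StateIndex n)

/-- The vector of the scalar coordinates of a state. -/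
def toVec (Q : NetState n) : StateSpace n :=
  WithLp.toLp 2 fun
    | .inl p => Q.P p.1 p.2.1 p.2.2
    | .inr (.inl p) => Q.y p.1 p.2
    | .inr (.inr (.inl p)) => Q.z p.1 p.2
    | .inr (.inr (.inr (.inl p))) => Q.K p.1 p.2.1 p.2.2
    | .inr (.inr (.inr (.inr (.inl p)))) => Q.lam p.1 p.2
    | .inr (.inr (.inr (.inr (.inr (.inl p))))) => Q.Theta p.1 p.2.1 p.2.2
    | .inr (.inr (.inr (.inr (.inr (.inr p))))) => Q.Upsilon p.1 p.2.1 p.2.2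

/-- The state with a given vector of scalar coordinates. -/
def ofVec (v : StateSpace n) : NetState n where
  P i := Matrix.of fun k l => v (.inl (i, k, l))
  y i k := v (.inr (.inl (i, k)))
  z i k := v (.inr (.inr (.inl (i, k))))
  K i := Matrix.of fun k l => v (.inr (.inr (.inr (.inl (i, k, l)))))
  lam i k := v (.inr (.inr (.inr (.inr (.inl (i, k))))))
  Theta i := Matrix.of fun k l => v (.inr (.inr (.inr (.inr (.inr (.inl (i, k, l)))))))
  Upsilon i := Matrix.of fun k l => v (.inr (.inr (.inr (.inr (.inr (.inr (i, k, l)))))))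

theorem ofVec_toVec (Q : NetState n) : ofVec (toVec Q) = Q := rfl

theorem toVec_ofVec (v : StateSpace n) : toVec (ofVec v) = v := by
  ext (p | p | p | p | p | p | p) <;> rfl

theorem inner_toVec (Q R : NetState n) :
    inner ℝ (toVec Q) (toVec R) =
      (∑ i, frobInner (Q.P i) (R.P i)) + (∑ i, Q.y i ⬝ᵥ R.y i) + (∑ i, Q.z i ⬝ᵥ R.z i)
        + (∑ i, frobInner (Q.K i) (R.K i)) + (∑ i, Q.lam i ⬝ᵥ R.lam i)
        + (∑ i, frobInner (Q.Theta i) (R.Theta i))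
        + ∑ i, frobInner (Q.Upsilon i) (R.Upsilon i) := by
  have hinner : ∀ a b : ℝ, inner ℝ a b = a * b := fun a b => mul_comm b a
  simp only [PiLp.inner_apply, Fintype.sum_sum_type, Fintype.sum_prod_type, hinner, toVec,
    frobInner, dotProduct]
  ring

theorem eucDist_eq_norm (Q R : NetState n) : Q.eucDist R = ‖toVec Q - toVec R‖ := by
  rw [EuclideanSpace.norm_eq, NetState.eucDist]
  congr 1
  simp only [Fintype.sum_sum_type, Fintype.sum_prod_type, Real.norm_eq_abs, sq_abs,
    PiLp.sub_apply, toVec]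
  ring

theorem hasVelocity_iff (Q : ℝ → NetState n) (D : NetState n) (t : ℝ) :
    HasVelocity Q D t ↔
      HasDerivWithinAt (fun s => toVec (Q s)) (toVec D) (Set.Ici 0) t := by
  have hpi : HasDerivWithinAt (fun s => toVec (Q s)) (toVec D) (Set.Ici 0) t ↔
      ∀ p, HasDerivWithinAt (fun s => toVec (Q s) p) (toVec D p) (Set.Ici 0) t := by
    rw [hasDerivWithinAt_iff_hasFDerivWithinAt, hasFDerivWithinAt_euclidean]
    refine forall_congr' fun p => ?_
    rw [hasDerivWithinAt_iff_hasFDerivWithinAt]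
    refine iff_of_eq ?_
    congr 1
  rw [hpi]
  constructor
  · rintro h (p | p | p | p | p | p | p)
    · exact h.P _ _ _
    · exact h.y _ _
    · exact h.z _ _
    · exact h.K _ _ _
    · exact h.lam _ _
    · exact h.Theta _ _ _
    · exact h.Upsilon _ _ _
  · intro h
    exact ⟨fun i k l => h (.inl (i, k, l)), fun i k => h (.inr (.inl (i, k))),
      fun i k => h (.inr (.inr (.inl (i, k)))),
      fun i k l => h (.inr (.inr (.inr (.inl (i, k, l))))),
      fun i k => h (.inr (.inr (.inr (.inr (.inl (i, k)))))),
      fun i k l => h (.inr (.inr (.inr (.inr (.inr (.inl (i, k, l))))))),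
      fun i k l => h (.inr (.inr (.inr (.inr (.inr (.inr (i, k, l)))))))⟩

end Coordinates

/-! ### The vector field of the algorithm -/

section Field

variable {n : ℕ} (G₁ G₂ : WeightedGraph n) (w : Fin n → Fin n → ℝ)

theorem onlyCol_add (i : Fin n) (u v : Fin n → ℝ) :
    onlyCol i (u + v) = onlyCol i u + onlyCol i v := by
  ext k l
  simp only [onlyCol, Matrix.of_apply, Matrix.add_apply]
  split_ifs <;> simp

theorem onlyCol_smul (i : Fin n) (c : ℝ) (v : Fin n → ℝ) :
    onlyCol i (c • v) = c • onlyCol i v := by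
  ext k l
  simp [onlyCol]

theorem onlyRow_add (i : Fin n) (u v : Fin n → ℝ) :
    onlyRow i (u + v) = onlyRow i u + onlyRow i v := by
  ext k l
  simp only [onlyRow, Matrix.of_apply, Matrix.add_apply]
  split_ifs <;> simp

theorem onlyRow_smul (i : Fin n) (c : ℝ) (v : Fin n → ℝ) :
    onlyRow i (c • v) = c • onlyRow i v := by
  ext k l
  simp [onlyRow]

theorem onlyCol_zero (i : Fin n) : onlyCol i (0 : Fin n → ℝ) = 0 := by
  ext k l
  simp [onlyCol]

theorem onlyRow_zero (i : Fin n) : onlyRow i (0 : Fin n → ℝ) = 0 := by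
  ext k l
  simp [onlyRow]

theorem toVec_algField_add (u v : StateSpace n) :
    toVec (algField G₁ G₂ w (ofVec (u + v))) =
      toVec (algField G₁ G₂ w (ofVec u)) + toVec (algField G₁ G₂ w (ofVec v)) := by
  have hP : (ofVec (u + v)).P = (ofVec u).P + (ofVec v).P := rfl
  have hy : (ofVec (u + v)).y = (ofVec u).y + (ofVec v).y := rfl
  have hz : (ofVec (u + v)).z = (ofVec u).z + (ofVec v).z := rfl
  have hK : (ofVec (u + v)).K = (ofVec u).K + (ofVec v).K := rfl
  have hl : (ofVec (u + v)).lam = (ofVec u).lam + (ofVec v).lam := rfl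
  have hT : (ofVec (u + v)).Theta = (ofVec u).Theta + (ofVec v).Theta := rfl
  have hU : (ofVec (u + v)).Upsilon = (ofVec u).Upsilon + (ofVec v).Upsilon := rfl
  ext (⟨i, k, l⟩ | ⟨i, k⟩ | ⟨i, k⟩ | ⟨i, k, l⟩ | ⟨i, k⟩ | ⟨i, k, l⟩ | ⟨i, k, l⟩)
  · refine congr_fun₂ (?_ : (algField G₁ G₂ w (ofVec (u + v))).P i =
      (algField G₁ G₂ w (ofVec u)).P i + (algField G₁ G₂ w (ofVec v)).P i) k l
    simp only [algField, hP, hy, hz, hl, hT, ← projD_add]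
    congr 1
    simp only [disagreement_add, Pi.add_apply, Matrix.add_mulVec, Matrix.vecMul_add,
      Matrix.vecMulVec_add, add_sub_add_comm, Matrix.add_vecMulVec]
    abel
  · refine congr_fun (?_ : (algField G₁ G₂ w (ofVec (u + v))).y i =
      (algField G₁ G₂ w (ofVec u)).y i + (algField G₁ G₂ w (ofVec v)).y i) k
    ext k
    simp only [algField, hP, hy, hU, Pi.add_apply, Matrix.add_mulVec, Pi.sub_apply,
      Matrix.add_apply]
    ring
  · refine congr_fun (?_ : (algField G₁ G₂ w (ofVec (u + v))).z i =
      (algField G₁ G₂ w (ofVec u)).z i + (algField G₁ G₂ w (ofVec v)).z i) k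
    ext k
    simp only [algField, hP, hz, hl, hU, Pi.add_apply, Matrix.vecMul_add, Pi.sub_apply,
      Matrix.add_apply]
    ring
  · refine congr_fun₂ (?_ : (algField G₁ G₂ w (ofVec (u + v))).K i =
      (algField G₁ G₂ w (ofVec u)).K i + (algField G₁ G₂ w (ofVec v)).K i) k l
    simp only [algField, hU, disagreement_add]
  · refine congr_fun (?_ : (algField G₁ G₂ w (ofVec (u + v))).lam i =
      (algField G₁ G₂ w (ofVec u)).lam i + (algField G₁ G₂ w (ofVec v)).lam i) k
    simp only [algField, hP, hz, Pi.add_apply, Matrix.vecMul_add, add_sub_add_comm]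
  · refine congr_fun₂ (?_ : (algField G₁ G₂ w (ofVec (u + v))).Theta i =
      (algField G₁ G₂ w (ofVec u)).Theta i + (algField G₁ G₂ w (ofVec v)).Theta i) k l
    simp only [algField, hP, disagreement_add]
  · refine congr_fun₂ (?_ : (algField G₁ G₂ w (ofVec (u + v))).Upsilon i =
      (algField G₁ G₂ w (ofVec u)).Upsilon i + (algField G₁ G₂ w (ofVec v)).Upsilon i) k l
    simp only [algField, hy, hz, hK, hU, disagreement_add, Pi.add_apply, onlyCol_add, onlyRow_add]
    abel

theorem toVec_algField_smul (c : ℝ) (v : StateSpace n) :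
    toVec (algField G₁ G₂ w (ofVec (c • v))) = c • toVec (algField G₁ G₂ w (ofVec v)) := by
  have hP : (ofVec (c • v)).P = c • (ofVec v).P := rfl
  have hy : (ofVec (c • v)).y = c • (ofVec v).y := rfl
  have hz : (ofVec (c • v)).z = c • (ofVec v).z := rfl
  have hK : (ofVec (c • v)).K = c • (ofVec v).K := rfl
  have hl : (ofVec (c • v)).lam = c • (ofVec v).lam := rfl
  have hT : (ofVec (c • v)).Theta = c • (ofVec v).Theta := rfl
  have hU : (ofVec (c • v)).Upsilon = c • (ofVec v).Upsilon := rfl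
  ext (⟨i, k, l⟩ | ⟨i, k⟩ | ⟨i, k⟩ | ⟨i, k, l⟩ | ⟨i, k⟩ | ⟨i, k, l⟩ | ⟨i, k, l⟩)
  · refine congr_fun₂ (?_ : (algField G₁ G₂ w (ofVec (c • v))).P i =
      c • (algField G₁ G₂ w (ofVec v)).P i) k l
    simp only [algField, hP, hy, hz, hl, hT, ← projD_smul]
    congr 1
    simp only [disagreement_smul, Pi.smul_apply, Matrix.smul_mulVec, Matrix.vecMul_smul,
      Matrix.vecMulVec_smul, ← smul_sub, Matrix.smul_vecMulVec, ← smul_neg]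
  · refine congr_fun (?_ : (algField G₁ G₂ w (ofVec (c • v))).y i =
      c • (algField G₁ G₂ w (ofVec v)).y i) k
    ext k
    simp only [algField, hP, hy, hU, Pi.smul_apply, Matrix.smul_mulVec, Pi.sub_apply,
      Matrix.smul_apply, smul_eq_mul]
    ring
  · refine congr_fun (?_ : (algField G₁ G₂ w (ofVec (c • v))).z i =
      c • (algField G₁ G₂ w (ofVec v)).z i) k
    ext k
    simp only [algField, hP, hz, hl, hU, Pi.smul_apply, Matrix.vecMul_smul, Pi.sub_apply,
      Matrix.smul_apply, Pi.add_apply, smul_eq_mul]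
    ring
  · refine congr_fun₂ (?_ : (algField G₁ G₂ w (ofVec (c • v))).K i =
      c • (algField G₁ G₂ w (ofVec v)).K i) k l
    simp only [algField, hU, disagreement_smul]
  · refine congr_fun (?_ : (algField G₁ G₂ w (ofVec (c • v))).lam i =
      c • (algField G₁ G₂ w (ofVec v)).lam i) k
    simp only [algField, hP, hz, Pi.smul_apply, Matrix.vecMul_smul, smul_sub]
  · refine congr_fun₂ (?_ : (algField G₁ G₂ w (ofVec (c • v))).Theta i =
      c • (algField G₁ G₂ w (ofVec v)).Theta i) k l
    simp only [algField, hP, disagreement_smul]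
  · refine congr_fun₂ (?_ : (algField G₁ G₂ w (ofVec (c • v))).Upsilon i =
      c • (algField G₁ G₂ w (ofVec v)).Upsilon i) k l
    simp only [algField, hy, hz, hK, hU, disagreement_smul, Pi.smul_apply, onlyCol_smul,
      onlyRow_smul, smul_sub]

/-- The vector field of the algorithm as a linear operator on the Euclidean space of states. -/
noncomputable def algLin : StateSpace n →L[ℝ] StateSpace n :=
  LinearMap.toContinuousLinearMap
    { toFun := fun v => toVec (algField G₁ G₂ w (ofVec v))
      map_add' := toVec_algField_add G₁ G₂ w
      map_smul' := toVec_algField_smul G₁ G₂ w }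

theorem algLin_apply (v : StateSpace n) :
    algLin G₁ G₂ w v = toVec (algField G₁ G₂ w (ofVec v)) := rfl

/-- The states whose `P`-components annihilate the all-ones vector; differences of admissible
states lie here. -/
def annihilatorSubspace (n : ℕ) : Submodule ℝ (StateSpace n) where
  carrier := {v | ∀ i, (ofVec v).P i *ᵥ 1 = 0}
  add_mem' {u v} hu hv i := by
    have h : (ofVec (u + v)).P i = (ofVec u).P i + (ofVec v).P i := rfl
    rw [h, Matrix.add_mulVec, hu i, hv i, add_zero]
  zero_mem' i := by
    have h : (ofVec (0 : StateSpace n)).P i = 0 := rfl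
    rw [h, Matrix.zero_mulVec]
  smul_mem' c v hv i := by
    have h : (ofVec (c • v)).P i = c • (ofVec v).P i := rfl
    rw [h, Matrix.smul_mulVec, hv i, smul_zero]

theorem algLin_mem_annihilatorSubspace (v : StateSpace n) :
    algLin G₁ G₂ w v ∈ annihilatorSubspace n := by
  intro i
  rw [algLin_apply, ofVec_toVec]
  exact projD_mulVec_one _

variable {w} {H : SimpleGraph (Fin n)}

/-- The energy balance: only the residuals and the disagreements of `P` and `Upsilon` dissipate
energy, since the coupling of primal and dual variables is skew. -/
theorem inner_algField (hw : IsEdgeWeight H w) {Q : NetState n} (hQ : ∀ i, Q.P i *ᵥ 1 = 0) :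
    inner ℝ (toVec Q) (toVec (algField G₁ G₂ w Q)) =
      -((∑ i, (Q.P i *ᵥ (fun k => G₁.adj k i) - Q.y i) ⬝ᵥ
            (Q.P i *ᵥ (fun k => G₁.adj k i) - Q.y i))
        + (∑ i, ((fun k => G₂.adj k i) ᵥ* Q.P i - Q.z i) ⬝ᵥ
            ((fun k => G₂.adj k i) ᵥ* Q.P i - Q.z i))
        + (∑ i, frobInner (Q.P i) (disagreement w Q.P i))
        + ∑ i, frobInner (Q.Upsilon i) (disagreement w Q.Upsilon i)) := by
  have h1 := sum_frobInner_disagreement_comm hw.symm Q.P Q.Theta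
  have h2 := sum_frobInner_disagreement_comm hw.symm Q.K Q.Upsilon
  have key : ∀ i, frobInner (Q.P i) ((algField G₁ G₂ w Q).P i)
      + Q.y i ⬝ᵥ (algField G₁ G₂ w Q).y i + Q.z i ⬝ᵥ (algField G₁ G₂ w Q).z i
      + frobInner (Q.K i) ((algField G₁ G₂ w Q).K i)
      + Q.lam i ⬝ᵥ (algField G₁ G₂ w Q).lam i
      + frobInner (Q.Theta i) ((algField G₁ G₂ w Q).Theta i)
      + frobInner (Q.Upsilon i) ((algField G₁ G₂ w Q).Upsilon i) =
      -((Q.P i *ᵥ (fun k => G₁.adj k i) - Q.y i) ⬝ᵥ (Q.P i *ᵥ (fun k => G₁.adj k i) - Q.y i)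
        + ((fun k => G₂.adj k i) ᵥ* Q.P i - Q.z i) ⬝ᵥ ((fun k => G₂.adj k i) ᵥ* Q.P i - Q.z i)
        + frobInner (Q.P i) (disagreement w Q.P i)
        + frobInner (Q.Upsilon i) (disagreement w Q.Upsilon i))
      + (frobInner (Q.Theta i) (disagreement w Q.P i)
          - frobInner (Q.P i) (disagreement w Q.Theta i))
      + (frobInner (Q.K i) (disagreement w Q.Upsilon i)
          - frobInner (Q.Upsilon i) (disagreement w Q.K i)) := by
    intro i
    simp only [algField, frobInner_projD (hQ i), frobInner_sub_right, frobInner_neg_right,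
      frobInner_onlyCol, frobInner_onlyRow]
    rw [frobInner_vecMulVec, frobInner_vecMulVec', frobInner_vecMulVec']
    set p := Q.P i *ᵥ (fun k => G₁.adj k i)
    set q := (fun k => G₂.adj k i) ᵥ* Q.P i
    simp only [sub_dotProduct, dotProduct_sub, dotProduct_add]
    rw [dotProduct_comm (Q.y i) p, dotProduct_comm (Q.z i) q, dotProduct_comm (Q.lam i) q,
      dotProduct_comm (Q.lam i) (Q.z i)]
    ring
  rw [inner_toVec]
  simp only [← Finset.sum_add_distrib, key]
  rw [Finset.sum_add_distrib, Finset.sum_add_distrib, Finset.sum_sub_distrib,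
    Finset.sum_sub_distrib, h1, h2, Finset.sum_neg_distrib]
  ring

/-- The states at which no energy is dissipated: the residuals vanish, and the estimates `P` and
the multipliers `Upsilon` are in consensus. -/
structure NoDissipation (Q : NetState n) : Prop where
  P_mulVec : ∀ i, Q.P i *ᵥ (fun k => G₁.adj k i) = Q.y i
  vecMul_P : ∀ i, (fun k => G₂.adj k i) ᵥ* Q.P i = Q.z i
  P_eq : ∀ i j, Q.P i = Q.P j
  Upsilon_eq : ∀ i j, Q.Upsilon i = Q.Upsilon j

theorem inner_algField_nonpos (hw : IsEdgeWeight H w) {Q : NetState n}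
    (hQ : ∀ i, Q.P i *ᵥ 1 = 0) : inner ℝ (toVec Q) (toVec (algField G₁ G₂ w Q)) ≤ 0 := by
  rw [inner_algField G₁ G₂ hw hQ, neg_nonpos]
  have hd : ∀ u : Fin n → ℝ, 0 ≤ u ⬝ᵥ u := fun u =>
    Finset.sum_nonneg fun _ _ => mul_self_nonneg _
  have h1 := sum_frobInner_disagreement_self_nonneg hw Q.P
  have h2 := sum_frobInner_disagreement_self_nonneg hw Q.Upsilon
  have h3 := Finset.sum_nonneg fun i (_ : i ∈ Finset.univ) =>
    hd (Q.P i *ᵥ (fun k => G₁.adj k i) - Q.y i)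
  have h4 := Finset.sum_nonneg fun i (_ : i ∈ Finset.univ) =>
    hd ((fun k => G₂.adj k i) ᵥ* Q.P i - Q.z i)
  linarith

theorem noDissipation_of_inner_eq_zero (hH : H.Connected) (hw : IsEdgeWeight H w)
    {Q : NetState n} (hQ : ∀ i, Q.P i *ᵥ 1 = 0)
    (h0 : inner ℝ (toVec Q) (toVec (algField G₁ G₂ w Q)) = 0) : NoDissipation G₁ G₂ Q := by
  rw [inner_algField G₁ G₂ hw hQ, neg_eq_zero] at h0
  have hd : ∀ u : Fin n → ℝ, 0 ≤ u ⬝ᵥ u := fun u =>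
    Finset.sum_nonneg fun _ _ => mul_self_nonneg _
  have hz : ∀ u : Fin n → Fin n → ℝ, ∑ i, u i ⬝ᵥ u i = 0 → ∀ i, u i = 0 := fun u hu i =>
    dotProduct_self_eq_zero.1
      ((Finset.sum_eq_zero_iff_of_nonneg fun i _ => hd (u i)).1 hu i (Finset.mem_univ i))
  have h1 := sum_frobInner_disagreement_self_nonneg hw Q.P
  have h2 := sum_frobInner_disagreement_self_nonneg hw Q.Upsilon
  have h3 := Finset.sum_nonneg fun i (_ : i ∈ Finset.univ) =>
    hd (Q.P i *ᵥ (fun k => G₁.adj k i) - Q.y i)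
  have h4 := Finset.sum_nonneg fun i (_ : i ∈ Finset.univ) =>
    hd ((fun k => G₂.adj k i) ᵥ* Q.P i - Q.z i)
  exact
    { P_mulVec := fun i => sub_eq_zero.1
        (hz (fun i => Q.P i *ᵥ (fun k => G₁.adj k i) - Q.y i) (by linarith) i)
      vecMul_P := fun i => sub_eq_zero.1
        (hz (fun i => (fun k => G₂.adj k i) ᵥ* Q.P i - Q.z i) (by linarith) i)
      P_eq := forall_eq_of_sum_frobInner_disagreement_eq_zero hH hw (by linarith)
      Upsilon_eq := forall_eq_of_sum_frobInner_disagreement_eq_zero hH hw (by linarith) }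

variable {G₁ G₂}

theorem NoDissipation.y_eq_zero {Q : NetState n} (h : NoDissipation G₁ G₂ Q) (hP : Q.P = 0) :
    Q.y = 0 := by
  ext1 i
  rw [← h.P_mulVec i, hP, Pi.zero_apply, Matrix.zero_mulVec, Pi.zero_apply]

theorem NoDissipation.z_eq_zero {Q : NetState n} (h : NoDissipation G₁ G₂ Q) (hP : Q.P = 0) :
    Q.z = 0 := by
  ext1 i
  rw [← h.vecMul_P i, hP, Pi.zero_apply, Matrix.vecMul_zero, Pi.zero_apply]

theorem NoDissipation.algField_lam {Q : NetState n} (h : NoDissipation G₁ G₂ Q) :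
    (algField G₁ G₂ w Q).lam = 0 := by
  ext1 i
  exact sub_eq_zero.2 (h.vecMul_P i)

theorem NoDissipation.algField_Theta {Q : NetState n} (h : NoDissipation G₁ G₂ Q) :
    (algField G₁ G₂ w Q).Theta = 0 :=
  funext fun i => disagreement_eq_zero_of_forall_eq h.P_eq i

theorem NoDissipation.algField_K {Q : NetState n} (h : NoDissipation G₁ G₂ Q) :
    (algField G₁ G₂ w Q).K = 0 :=
  funext fun i => disagreement_eq_zero_of_forall_eq h.Upsilon_eq i

theorem NoDissipation.algField_P {Q : NetState n} (h : NoDissipation G₁ G₂ Q)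
    (hl : Q.lam = 0) (hT : Q.Theta = 0) : (algField G₁ G₂ w Q).P = 0 := by
  funext i
  simp only [algField]
  rw [h.P_mulVec, h.vecMul_P, disagreement_eq_zero_of_forall_eq h.P_eq,
    disagreement_eq_zero_of_forall_eq (X := Q.Theta) (by simp [hT]), hl]
  simp [projD_zero]

theorem NoDissipation.algField_Upsilon {Q : NetState n} (h : NoDissipation G₁ G₂ Q)
    (hK : Q.K = 0) (hy : Q.y = 0) (hz : Q.z = 0) : (algField G₁ G₂ w Q).Upsilon = 0 := by
  funext i
  simp only [algField]
  rw [disagreement_eq_zero_of_forall_eq h.Upsilon_eq,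
    disagreement_eq_zero_of_forall_eq (X := Q.K) (by simp [hK]), hy, hz]
  simp [onlyCol_zero, onlyRow_zero]

/-- Along an orbit on which no energy is dissipated, first the multipliers `lam`, `Theta` and the
variables `K` come to rest, then `P`, `y` and `z`, and at last `Upsilon`. -/
theorem toVec_algField_iterate_three_eq_zero {Q₀ Q₁ Q₂ Q₃ : NetState n}
    (h₁ : Q₁ = algField G₁ G₂ w Q₀) (h₂ : Q₂ = algField G₁ G₂ w Q₁)
    (h₃ : Q₃ = algField G₁ G₂ w Q₂) (hQ₀ : NoDissipation G₁ G₂ Q₀)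
    (hQ₁ : NoDissipation G₁ G₂ Q₁) (hQ₂ : NoDissipation G₁ G₂ Q₂)
    (hQ₃ : NoDissipation G₁ G₂ Q₃) : toVec Q₃ = 0 := by
  have l1 : Q₁.lam = 0 := h₁ ▸ hQ₀.algField_lam
  have t1 : Q₁.Theta = 0 := h₁ ▸ hQ₀.algField_Theta
  have l2 : Q₂.lam = 0 := h₂ ▸ hQ₁.algField_lam
  have t2 : Q₂.Theta = 0 := h₂ ▸ hQ₁.algField_Theta
  have k2 : Q₂.K = 0 := h₂ ▸ hQ₁.algField_K
  have p2 : Q₂.P = 0 := h₂ ▸ hQ₁.algField_P l1 t1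
  have l3 : Q₃.lam = 0 := h₃ ▸ hQ₂.algField_lam
  have t3 : Q₃.Theta = 0 := h₃ ▸ hQ₂.algField_Theta
  have k3 : Q₃.K = 0 := h₃ ▸ hQ₂.algField_K
  have p3 : Q₃.P = 0 := h₃ ▸ hQ₂.algField_P l2 t2
  have u3 : Q₃.Upsilon = 0 :=
    h₃ ▸ hQ₂.algField_Upsilon k2 (hQ₂.y_eq_zero p2) (hQ₂.z_eq_zero p2)
  have h : Q₃ = ⟨0, 0, 0, 0, 0, 0, 0⟩ :=
    NetState.ext p3 (hQ₃.y_eq_zero p3) (hQ₃.z_eq_zero p3) k3 l3 t3 u3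
  rw [h]
  ext (p | p | p | p | p | p | p) <;> rfl

/-- An equilibrium whose estimates annihilate the all-ones vector has zero estimates: the common
estimate intertwines the adjacency matrices, as one sees by summing the `Upsilon`-equations. -/
theorem P_eq_zero_of_algLin_eq_zero (hG : G₁.Friendly) (hH : H.Connected)
    (hw : IsEdgeWeight H w) {v : StateSpace n} (hv : v ∈ annihilatorSubspace n)
    (h0 : algLin G₁ G₂ w v = 0) : (ofVec v).P = 0 := by
  have hN := noDissipation_of_inner_eq_zero G₁ G₂ hH hw (Q := ofVec v) hv
    (by rw [← algLin_apply, h0, inner_zero_right])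
  have hU : ∀ i, onlyCol i ((ofVec v).y i) - onlyRow i ((ofVec v).z i) =
      disagreement w (ofVec v).K i := by
    intro i
    have h : (algField G₁ G₂ w (ofVec v)).Upsilon i = 0 := by
      rw [← ofVec_toVec (algField G₁ G₂ w (ofVec v)), ← algLin_apply, h0]
      rfl
    simp only [algField, disagreement_eq_zero_of_forall_eq hN.Upsilon_eq, sub_zero] at h
    exact sub_eq_zero.1 h
  have hsum := sum_disagreement hw.symm (ofVec v).K
  simp only [← hU] at hsum
  funext i
  refine eq_zero_of_mul_adj_eq_adj_mul (G₂ := G₂) hG ?_ (hv i)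
  ext k l
  have hkl := congr_fun₂ hsum k l
  simp only [Matrix.sum_apply, Matrix.sub_apply, onlyCol, onlyRow, Matrix.of_apply,
    Finset.sum_sub_distrib, Finset.sum_ite_eq, Finset.mem_univ, if_true,
    Matrix.zero_apply] at hkl
  rw [← hN.P_mulVec l, ← hN.vecMul_P k, hN.P_eq l i, hN.P_eq k i, sub_eq_zero] at hkl
  rw [Matrix.mul_apply, Matrix.mul_apply]
  simp only [Matrix.mulVec, Matrix.vecMul, dotProduct] at hkl
  rw [hkl]
  exact Finset.sum_congr rfl fun m _ => by rw [G₂.symm.apply]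

/-- An isomorphism of the graphs is the common estimate of some equilibrium. -/
theorem exists_isEquilibrium (hH : H.Connected) (hw : IsEdgeWeight H w)
    {M : Matrix (Fin n) (Fin n) ℝ} (hM : M ∈ isoSet G₁ G₂) :
    ∃ R : NetState n, IsEquilibrium G₁ G₂ w R ∧ ∀ i, R.P i = M := by
  have hAB := mul_adj_eq_adj_mul_of_mem_isoSet hM
  obtain ⟨K, hK⟩ := exists_disagreement_eq hH hw
    (fun i => onlyCol i (M *ᵥ fun k => G₁.adj k i) - onlyRow i ((fun k => G₂.adj k i) ᵥ* M)) (by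
      ext k l
      simp only [Matrix.sum_apply, Matrix.sub_apply, onlyCol, onlyRow, Matrix.of_apply,
        Finset.sum_sub_distrib, Finset.sum_ite_eq, Finset.mem_univ, if_true, Matrix.zero_apply]
      have h := congr_fun₂ hAB k l
      rw [Matrix.mul_apply, Matrix.mul_apply] at h
      simp only [Matrix.mulVec, Matrix.vecMul, dotProduct]
      rw [h, sub_eq_zero]
      exact Finset.sum_congr rfl fun m _ => by rw [G₂.symm.apply])
  refine ⟨⟨fun _ => M, fun i => M *ᵥ fun k => G₁.adj k i, fun i => (fun k => G₂.adj k i) ᵥ* M,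
    K, 0, 0, 0⟩, ?_, fun _ => rfl⟩
  have hN : NoDissipation G₁ G₂ (⟨fun _ => M, fun i => M *ᵥ fun k => G₁.adj k i,
      fun i => (fun k => G₂.adj k i) ᵥ* M, K, 0, 0, 0⟩ : NetState n) :=
    ⟨fun _ => rfl, fun _ => rfl, fun _ _ => rfl, fun _ _ => rfl⟩
  refine NetState.ext (hN.algField_P rfl rfl) ?_ ?_ hN.algField_K hN.algField_lam
    hN.algField_Theta ?_
  · funext i k
    simp [algField]
  · funext i k
    simp [algField]
  · funext i
    simp only [algField, hK, disagreement_eq_zero_of_forall_eq hN.Upsilon_eq]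
    simp

/-- The exponential convergence of the linear flow, on the invariant subspace in which the
differences of admissible states lie. -/
theorem exists_exponential_decay_algLin (hH : H.Connected) (hw : IsEdgeWeight H w) :
    ∃ c > (0 : ℝ), ∃ α > (0 : ℝ), ∀ x ∈ annihilatorSubspace n, ∃ k ∈ annihilatorSubspace n,
      algLin G₁ G₂ w k = 0 ∧ ∀ t : ℝ, 0 ≤ t →
        ‖linFlow (algLin G₁ G₂ w) t x - k‖ ≤ c * ‖x - k‖ * Real.exp (-α * t) := by
  set M := algLin G₁ G₂ w with hMdef
  set S := annihilatorSubspace n with hS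
  let N : S →L[ℝ] S := (M.comp S.subtypeL).codRestrict S
    fun v => algLin_mem_annihilatorSubspace G₁ G₂ w v
  have hN : ∀ v : S, ((N v : S) : StateSpace n) = M v := fun v => rfl
  have hinner : ∀ v : S, inner ℝ v (N v) =
      inner ℝ (toVec (ofVec (v : StateSpace n))) (toVec (algField G₁ G₂ w (ofVec v))) := by
    intro v
    rw [toVec_ofVec]
    rfl
  have hd : ∀ v : S, inner ℝ v (N v) ≤ 0 := fun v => by
    rw [hinner]
    exact inner_algField_nonpos G₁ G₂ hw v.2
  have h3 : ∀ v : S, (∀ k : ℕ, inner ℝ ((N ^ k) v) (N ((N ^ k) v)) = 0) → (N ^ 3) v = 0 := by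
    intro v hv
    have hno : ∀ k : ℕ, NoDissipation G₁ G₂ (ofVec ((N ^ k) v : S)) := fun k =>
      noDissipation_of_inner_eq_zero G₁ G₂ hH hw ((N ^ k) v).2 (by rw [← hinner]; exact hv k)
    have hstep : ∀ k : ℕ, ofVec ((N ^ (k + 1)) v : S) =
        algField G₁ G₂ w (ofVec ((N ^ k) v : S)) := by
      intro k
      rw [pow_succ', mul_apply_eq_comp, hN, hMdef, algLin_apply, ofVec_toVec]
    have := toVec_algField_iterate_three_eq_zero (hstep 0) (hstep 1) (hstep 2) (hno 0) (hno 1)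
      (hno 2) (hno 3)
    rw [toVec_ofVec] at this
    exact Subtype.ext this
  obtain ⟨c, hc, α, hα, hdecay⟩ := exists_exponential_decay hd h3
  refine ⟨c, hc, α, hα, fun x hx => ?_⟩
  obtain ⟨k, hk, hle⟩ := hdecay ⟨x, hx⟩
  refine ⟨k, k.2, by rw [← hN, hk]; rfl, fun t ht => ?_⟩
  -- The flow of the restriction is the restriction of the flow, since both solve
  -- the same linear equation.
  have hexp := eq_linFlow_apply_of_hasDerivWithinAt (M := M)
    (u := fun s => ((linFlow N s ⟨x, hx⟩ : S) : StateSpace n))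
    (fun s _ => (S.subtypeL.hasFDerivAt.comp_hasDerivAt s
      (hasDerivAt_linFlow_apply N ⟨x, hx⟩ s)).hasDerivWithinAt) ht
  simp only [linFlow_zero_apply] at hexp
  rw [← hexp]
  exact hle t ht

end Field

/-! ### Trajectories and convergence -/

section Trajectories

variable {n : ℕ} {G₁ G₂ : WeightedGraph n} {w : Fin n → Fin n → ℝ}

theorem isEquilibrium_iff (R : NetState n) :
    IsEquilibrium G₁ G₂ w R ↔ algLin G₁ G₂ w (toVec R) = 0 := by
  have h0 : toVec (⟨0, 0, 0, 0, 0, 0, 0⟩ : NetState n) = 0 := by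
    ext (p | p | p | p | p | p | p) <;> rfl
  rw [IsEquilibrium, algLin_apply, ofVec_toVec, ← h0]
  exact ⟨fun h => congr_arg toVec h, fun h => congr_arg ofVec h⟩

theorem exists_isTrajectory (Q₀ : NetState n) : ∃ Q, IsTrajectory G₁ G₂ w Q₀ Q := by
  refine ⟨fun t => ofVec (linFlow (algLin G₁ G₂ w) t (toVec Q₀)), ?_, fun t _ => ?_⟩
  · simp only [linFlow_zero_apply, ofVec_toVec]
  · rw [hasVelocity_iff]
    simp only [toVec_ofVec]
    exact (hasDerivAt_linFlow_apply (algLin G₁ G₂ w) (toVec Q₀) t).hasDerivWithinAt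

theorem IsTrajectory.toVec_eq {Q₀ : NetState n} {Q : ℝ → NetState n}
    (h : IsTrajectory G₁ G₂ w Q₀ Q) {t : ℝ} (ht : 0 ≤ t) :
    toVec (Q t) = linFlow (algLin G₁ G₂ w) t (toVec Q₀) := by
  rw [← h.1]
  exact eq_linFlow_apply_of_hasDerivWithinAt (u := fun s => toVec (Q s))
    (fun s hs => (hasVelocity_iff _ _ _).1 (h.2 s hs)) ht

theorem frobNorm_sub_le_eucDist (Q R : NetState n) (i : Fin n) :
    frobNorm (Q.P i - R.P i) ≤ Q.eucDist R := by
  refine Real.sqrt_le_sqrt ?_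
  have h : ∑ k, ∑ l, (Q.P i - R.P i) k l ^ 2 ≤ ∑ i, ∑ k, ∑ l, (Q.P i k l - R.P i k l) ^ 2 :=
    Finset.single_le_sum (f := fun i => ∑ k, ∑ l, (Q.P i k l - R.P i k l) ^ 2)
      (fun i _ => by positivity) (Finset.mem_univ i)
  refine h.trans ?_
  simp only [add_assoc]
  exact le_add_of_nonneg_right (by positivity)

end Trajectories

theorem theorem3 (n : ℕ) (G₁ G₂ : WeightedGraph n)
    (hiso : Isomorphic G₁ G₂)
    (hasymm₁ : G₁.Asymmetric) (hasymm₂ : G₂.Asymmetric)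
    (hfriendly₁ : G₁.Friendly) (hfriendly₂ : G₂.Friendly)
    (H : SimpleGraph (Fin n)) (hH : H.Connected)
    (w : Fin n → Fin n → ℝ) (hw : IsEdgeWeight H w) :
    ∃ Pstar : Matrix (Fin n) (Fin n) ℝ, isoSet G₁ G₂ = {Pstar} ∧
      (∀ Q₀ : NetState n, IsInitialState Q₀ →
        ∃ Q : ℝ → NetState n, IsTrajectory G₁ G₂ w Q₀ Q) ∧
      ∃ c > (0 : ℝ), ∃ α > (0 : ℝ),
        ∀ (Q₀ : NetState n) (Q : ℝ → NetState n), IsInitialState Q₀ →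
          IsTrajectory G₁ G₂ w Q₀ Q →
          ∃ Qbar : NetState n, IsEquilibrium G₁ G₂ w Qbar ∧
            ∀ t : ℝ, 0 ≤ t →
              (Q t).eucDist Qbar ≤ c * Q₀.eucDist Qbar * Real.exp (-α * t) ∧
              ∀ i, frobNorm ((Q t).P i - Pstar) ≤
                c * Q₀.eucDist Qbar * Real.exp (-α * t) := by
  obtain ⟨M, hM⟩ := hiso
  refine ⟨M, (subsingleton_isoSet hfriendly₁).eq_singleton_of_mem hM,
    fun Q₀ _ => exists_isTrajectory Q₀, ?_⟩
  obtain ⟨R, hR, hRP⟩ := exists_isEquilibrium hH hw hM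
  rw [isEquilibrium_iff] at hR
  obtain ⟨c, hc, α, hα, hdecay⟩ := exists_exponential_decay_algLin (G₁ := G₁) (G₂ := G₂) hH hw
  refine ⟨c, hc, α, hα, fun Q₀ Q hQ₀ hQ => ?_⟩
  have hmem : toVec Q₀ - toVec R ∈ annihilatorSubspace n := by
    intro i
    have h : (ofVec (toVec Q₀ - toVec R)).P i = Q₀.P i - R.P i := rfl
    have hQ₀i : Q₀.P i *ᵥ 1 = 1 := hQ₀ i
    rw [h, Matrix.sub_mulVec, hQ₀i, hRP, hM.1.2.1, sub_self]
  -- The limit of the trajectory is `R + k`, where `k` is the limit of the linear flow started at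
  -- the difference of the initial state and the equilibrium `R`.
  obtain ⟨k, hkmem, hk, hle⟩ := hdecay _ hmem
  have hbar : toVec (ofVec (toVec R + k)) = toVec R + k := toVec_ofVec _
  have hP : ∀ i, (ofVec (toVec R + k)).P i = M := by
    intro i
    have h : (ofVec (toVec R + k)).P i = R.P i + (ofVec k).P i := rfl
    rw [h, P_eq_zero_of_algLin_eq_zero hfriendly₁ hH hw hkmem hk, hRP, Pi.zero_apply, add_zero]
  have hdist : ∀ t : ℝ, 0 ≤ t → (Q t).eucDist (ofVec (toVec R + k)) ≤
      c * Q₀.eucDist (ofVec (toVec R + k)) * Real.exp (-α * t) := by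
    intro t ht
    have h := hle t ht
    rw [map_sub, linFlow_apply_of_map_eq_zero hR, ← hQ.toVec_eq ht, sub_sub, sub_sub] at h
    rwa [eucDist_eq_norm, eucDist_eq_norm, hbar]
  refine ⟨ofVec (toVec R + k), ?_, fun t ht => ⟨hdist t ht, fun i => ?_⟩⟩
  · rw [isEquilibrium_iff, hbar, map_add, hR, hk, add_zero]
  · rw [← hP i]
    exact (frobNorm_sub_le_eucDist _ _ i).trans (hdist t ht)
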